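/- Let $\mathbb N=\{0,1,2,\dots\}$ and let $S\subseteq\mathbb N$ be a numerical semigroup (a submonoid of $(\mathbb N,+)$ with finite complement) generated by positive integers $a_1<\dots<a_p$. For $s\in\mathbb N$ let $\mathsf Z(s)=\{x\in\mathbb N^p : \sum_i a_ix_i=s\}$, for $x\in\mathbb N^p$ let $\ell(x)=x_1+\dots+x_p$, and let $\mathcal L(s)=\{\ell(x): x\in\mathsf Z(s)\}$. For $n\in\mathbb N$ put $\mathsf W(n)=\{s\in S: \exists x\in \mathsf Z(s),\ \ell(x)=n\}$ and $\nu(n)=\bigcup_{s\in \mathsf W(n)}\mathcal L(s)=\{l_1<\dots<l_r\}$, and let $\Delta\nu(n)=\{l_2-l_1,\dots,l_r-l_{r-1}\}$. Let $\delta=\mathrm{lcm}(a_1,a_p)$. Then the function $n\mapsto\Delta\nu(n)$ is eventually periodic with (not necessarily least) period $\delta$: there is $N\in\mathbb N$ such that $\Delta\nu(n+\delta)=\Delta\nu(n)$ for all integers $n\ge N$. Moreover, if $p\ge 3$, then $\Delta\nu(n+\delta)=\Delta\nu(n)$ for every integer $n\ge N_0$, where $N_0$ is defined as follows. Put $d=\gcd\{a_{i+1}-a_i: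 1\le i\le p-1\}$ and, for $2\le i\le p-1$, $g_i=\gcd(a_i-a_1,\,a_1-a_p,\,a_p-a_i)$, \[ S_i=-\frac{a_2\left(a_1 d g_i+(p-2)(a_1-a_i)(a_1-a_p)\right)}{(a_1-a_2)g_i},\qquad S_i'=\frac{a_{p-1}\left((p-2)(a_1-a_p)(a_p-a_i)-d a_p g_i\right)}{(a_{p-1}-a_p)g_i}. \] Let $N_S=\left\lceil\max\left(\{S_i: 2\le i\le p-1\}\cup\{S'_i: 2\le i\le p-1\}\right)\right\rceil$ and \[ C_1=\frac{(a_p-a_{p-1})N_S}{a_{p-1}},\qquad C_2=\frac{(a_1-a_2)N_S}{a_2}, \] \[ C_3=\left(-\frac{a_p}{a_1}+\frac{a_p}{a_2}-\frac{a_p}{a_{p-1}}+1\right)N_S,\qquad C_4=\left(\frac{a_1}{a_{p-1}}-\frac{a_1}{a_p}-\frac{a_1}{a_2}+1\right)N_S, \] $\lambda_1=\max(C_1,C_4)$, $\lambda_2=-\min(C_2,C_3)$, and \[ N_0=\max\left(\frac{N_S}{a_1},\ \frac{a_p-a_1+\lambda_1+\lambda_2}{a_p-a_1}\right). \] -/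

import Mathlib

/-- A numerical semigroup: a submonoid of `(ℕ, +)` with finite complement
(equivalently, one whose elements have greatest common divisor `1`). -/
def IsNumericalSemigroup (S : AddSubmonoid ℕ) : Prop :=
  ((S : Set ℕ)ᶜ).Finite

namespace NumSemi

variable {p : ℕ}

/-- The generator `a_i` of `⟨a_1 < ⋯ < a_p⟩`, numbered from `1` to `p`
(with the irrelevant value `0` for other `i`). -/
def gen (a : Fin p → ℕ) (i : ℕ) : ℕ :=
  if h : 1 ≤ i ∧ i ≤ p then a ⟨i - 1, by omega⟩ else 0

/-- The set `Z(s)` of factorizations of `s` with respect to the generators `a`. -/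
def factorizations (a : Fin p → ℕ) (s : ℕ) : Set (Fin p → ℕ) :=
  {x | ∑ i, x i * a i = s}

/-- The length of a factorization. -/
def len (x : Fin p → ℕ) : ℕ := ∑ i, x i

/-- The set of lengths `𝓛(s)`. -/
def lengths (a : Fin p → ℕ) (s : ℕ) : Set ℕ :=
  len '' factorizations a s

/-- `W(n)`: the elements of `S` that have a factorization of length `n`. -/
def W (S : AddSubmonoid ℕ) (a : Fin p → ℕ) (n : ℕ) : Set ℕ :=
  {s | s ∈ S ∧ ∃ x ∈ factorizations a s, len x = n}

/-- `ν(n)`: the union of the sets of lengths of the elements of `W(n)`. -/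
def nu (S : AddSubmonoid ℕ) (a : Fin p → ℕ) (n : ℕ) : Set ℕ :=
  ⋃ s ∈ W S a n, lengths a s

/-- The set of differences of consecutive elements of a set of natural numbers. -/
def delta (X : Set ℕ) : Set ℕ :=
  {e | ∃ l ∈ X, ∃ l' ∈ X, l < l' ∧ (∀ k ∈ X, ¬(l < k ∧ k < l')) ∧ l' = l + e}

/-- `Δν(n)`. -/
def deltaNu (S : AddSubmonoid ℕ) (a : Fin p → ℕ) (n : ℕ) : Set ℕ :=
  delta (nu S a n)

/-- `δ` is a positive (not necessarily least) period of `f` on the natural numbers `n ≥ N`. -/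
def PeriodicFrom {α : Type*} (f : ℕ → α) (δ : ℕ) (N : ℚ) : Prop :=
  0 < δ ∧ ∀ n : ℕ, N ≤ (n : ℚ) → f (n + δ) = f n

/-- `d = gcd {a_{i+1} - a_i : i = 1, …, p - 1}` (for increasing `a`). -/
def dGcd (a : Fin p → ℕ) : ℕ :=
  (Finset.Icc 1 (p - 1)).gcd fun i => gen a (i + 1) - gen a i

/-- `gcd (a_i - a_1, a_1 - a_p, a_p - a_i)`. -/
def gGcd (a : Fin p → ℕ) (i : ℕ) : ℕ :=
  Nat.gcd ((gen a i : ℤ) - gen a 1).natAbs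
    (Nat.gcd ((gen a 1 : ℤ) - gen a p).natAbs ((gen a p : ℤ) - gen a i).natAbs)

/-- The number `S_i`. -/
def boundS (a : Fin p → ℕ) (i : ℕ) : ℚ :=
  -((gen a 2 : ℚ) * ((gen a 1 : ℚ) * dGcd a * gGcd a i
      + ((p : ℚ) - 2) * ((gen a 1 : ℚ) - gen a i) * ((gen a 1 : ℚ) - gen a p)))
    / (((gen a 1 : ℚ) - gen a 2) * gGcd a i)

/-- The number `S'_i`. -/
def boundS' (a : Fin p → ℕ) (i : ℕ) : ℚ :=
  ((gen a (p - 1) : ℚ) * (((p : ℚ) - 2) * ((gen a 1 : ℚ) - gen a p) * ((gen a p : ℚ) - gen a i)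
      - (dGcd a : ℚ) * gen a p * gGcd a i))
    / (((gen a (p - 1) : ℚ) - gen a p) * gGcd a i)

/-- `N_S = ⌈max ({S_i : 2 ≤ i ≤ p - 1} ∪ {S'_i : 2 ≤ i ≤ p - 1})⌉`; this needs `p ≥ 3`. -/
def NS (a : Fin p → ℕ) (hp : 3 ≤ p) : ℤ :=
  ⌈(Finset.Icc 2 (p - 1)).sup' (Finset.nonempty_Icc.2 (by omega))
    fun i => max (boundS a i) (boundS' a i)⌉

/-- `C_1` -/
def C1 (a : Fin p → ℕ) (hp : 3 ≤ p) : ℚ :=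
  ((gen a p : ℚ) - gen a (p - 1)) * NS a hp / gen a (p - 1)

/-- `C_2` -/
def C2 (a : Fin p → ℕ) (hp : 3 ≤ p) : ℚ :=
  ((gen a 1 : ℚ) - gen a 2) * NS a hp / gen a 2

/-- `C_3` -/
def C3 (a : Fin p → ℕ) (hp : 3 ≤ p) : ℚ :=
  (-((gen a p : ℚ) / gen a 1) + (gen a p : ℚ) / gen a 2
    - (gen a p : ℚ) / gen a (p - 1) + 1) * NS a hp

/-- `C_4` -/
def C4 (a : Fin p → ℕ) (hp : 3 ≤ p) : ℚ :=
  ((gen a 1 : ℚ) / gen a (p - 1) - (gen a 1 : ℚ) / gen a p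
    - (gen a 1 : ℚ) / gen a 2 + 1) * NS a hp

/-- `λ_1 = max (C_1, C_4)` -/
def lam1 (a : Fin p → ℕ) (hp : 3 ≤ p) : ℚ := max (C1 a hp) (C4 a hp)

/-- `λ_2 = - min (C_2, C_3)` -/
def lam2 (a : Fin p → ℕ) (hp : 3 ≤ p) : ℚ := -min (C2 a hp) (C3 a hp)

/-- `N_0 = max (N_S / a_1, (a_p - a_1 + λ_1 + λ_2) / (a_p - a_1))` -/
def N0 (a : Fin p → ℕ) (hp : 3 ≤ p) : ℚ :=
  max ((NS a hp : ℚ) / gen a 1)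
    (((gen a p : ℚ) - gen a 1 + lam1 a hp + lam2 a hp) / ((gen a p : ℚ) - gen a 1))

end NumSemi

/-! The set ν(n) consists of the lengths sharing an element with n. If x and y factor one element
with lengths u and v, cancelling that element gives a_p u - a_1 v = ∑ x_i (a_p - a_i) + ∑ y_i (a_i -
a_1), so this number t lies in the monoid generated by the gaps to the two extreme generators.
Conversely, a representation of t with few enough terms yields two factorizations
(`commonLengths_of_eq`), and for u ≤ v with v large such a representation always exists
(`GapData.commonLengths_iff`). When t is large, the interior coefficients are reduced by exchanging
interior gaps for a_p - a_1; when t is small, every representation is short.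

So for large n, membership of m in ν(n) depends only on a_p m - a_1 n if m ≤ n, and only on a_p n -
a_1 m if m ≥ n. Passing from n to n + δ translates the part of ν(n) below n by a_1 δ / a_p and the
part above n by a_p δ / a_1. Between them t is large, so the new middle is an arithmetic progression
of difference d. Since d already occurs in Δν(n), nothing changes (`delta_eq_of_stretch`,
`GapData.delta_add`).

For the explicit threshold, S_i and S'_i bound p - 2 times a single interior term, and averaging
over i bounds the sums. The bound n ≥ N_S / a_1 alone already suffices. -/

namespace NumSemi

open Finset

set_option linter.unusedSectionVars false

/-! ### Common lengths and sums of gaps -/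

section Exchange

variable {ι : Type*} [Fintype ι] [DecidableEq ι]

/-- `u` and `v` are lengths of two factorizations of a common element. -/
def CommonLengths (a : ι → ℤ) (u v : ℕ) : Prop :=
  ∃ x y : ι → ℕ, ∑ i, x i = u ∧ ∑ i, y i = v ∧ ∑ i, (x i : ℤ) * a i = ∑ i, (y i : ℤ) * a i

/-- `t` lies in the monoid generated by the distances of the generators to the two extreme ones. -/
def IsGapSum (a : ι → ℤ) (i₀ i₁ : ι) (t : ℤ) : Prop :=
  ∃ x y : ι → ℕ, t = ∑ i, (x i : ℤ) * (a i₁ - a i) + ∑ i, (y i : ℤ) * (a i - a i₀)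

variable {a : ι → ℤ} {i₀ i₁ : ι}

theorem CommonLengths.symm {u v : ℕ} (h : CommonLengths a u v) : CommonLengths a v u := by
  obtain ⟨x, y, hx, hy, hxy⟩ := h
  exact ⟨y, x, hy, hx, hxy.symm⟩

theorem CommonLengths.refl [Nonempty ι] (u : ℕ) : CommonLengths a u u := by
  classical
  obtain ⟨i⟩ := ‹Nonempty ι›
  exact ⟨Pi.single i u, Pi.single i u, by simp, by simp, rfl⟩

theorem CommonLengths.isGapSum {u v : ℕ} (h : CommonLengths a u v) :
    IsGapSum a i₀ i₁ (a i₁ * u - a i₀ * v) := by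
  obtain ⟨x, y, rfl, rfl, hxy⟩ := h
  refine ⟨x, y, ?_⟩
  simp only [mul_sub, sum_sub_distrib, ← sum_mul, hxy]
  push_cast
  ring

/-- A representation as a sum of distances with few terms comes from two factorizations. -/
theorem commonLengths_of_eq {u v : ℕ} {x y : ι → ℕ}
    (hx : ∑ i ∈ univ.erase i₁, x i ≤ u) (hy : ∑ i ∈ univ.erase i₀, y i ≤ v)
    (ht : a i₁ * u - a i₀ * v
      = ∑ i, (x i : ℤ) * (a i₁ - a i) + ∑ i, (y i : ℤ) * (a i - a i₀)) :
    CommonLengths a u v := by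
  have key : ∀ (j : ι) (w : ι → ℕ) (n : ℕ), ∑ i ∈ univ.erase j, w i ≤ n →
      ∃ w' : ι → ℕ, ∑ i, w' i = n ∧
        ∑ i, (w i : ℤ) * (a i - a j) = ∑ i, (w' i : ℤ) * a i - n * a j := by
    intro j w n hn
    -- The j-th coefficient multiplies the zero gap a j - a j, so it can be overwritten to make the
    -- length exactly n.
    refine ⟨Function.update w j (n - ∑ i ∈ univ.erase j, w i), ?_, ?_⟩
    · rw [← add_sum_erase univ _ (mem_univ j), sum_congr rfl fun i hi =>
        Function.update_of_ne (ne_of_mem_erase hi) _ _, Function.update_self]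
      omega
    · rw [← add_sum_erase univ _ (mem_univ j),
        ← add_sum_erase univ (fun i => ((Function.update w j _ i : ℕ) : ℤ) * a i) (mem_univ j)]
      have e : ∀ m : ℕ, ∑ i ∈ univ.erase j, ((Function.update w j m i : ℕ) : ℤ) * a i
          = ∑ i ∈ univ.erase j, (w i : ℤ) * a i := fun m =>
        sum_congr rfl fun i hi => by rw [Function.update_of_ne (ne_of_mem_erase hi)]
      rw [e]
      simp only [Function.update_self, mul_sub, sum_sub_distrib, ← sum_mul]
      push_cast [Nat.cast_sub hn]
      ring
  obtain ⟨x', hx', hxe⟩ := key i₁ x u hx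
  obtain ⟨y', hy', hye⟩ := key i₀ y v hy
  refine ⟨x', y', hx', hy', ?_⟩
  have : ∑ i, (x i : ℤ) * (a i₁ - a i) = -∑ i, (x i : ℤ) * (a i - a i₁) := by
    rw [← sum_neg_distrib]
    exact sum_congr rfl fun i _ => by ring
  rw [this, hxe, hye] at ht
  linarith

/-- Reducing the coefficients of an integral combination modulo `B` to a bounded range. -/
theorem exists_reduced_coeffs {s : Finset ι} {c h w : ι → ℤ} {B r : ℤ} (hB : 0 < B)
    (hc : ∀ i ∈ s, 0 ≤ c i) (hh : ∀ i ∈ s, 0 < h i) (hdvd : ∀ i ∈ s, B ∣ h i * c i)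
    (ht : ∑ i ∈ s, h i * c i ≤ ∑ i ∈ s, w i * c i + r * B) :
    ∃ (z : ι → ℕ) (q : ℕ), ∑ i ∈ s, w i * c i + r * B = ∑ i ∈ s, (z i : ℤ) * c i + q * B ∧
      ∑ i ∈ s, (z i : ℤ) * c i ≤ ∑ i ∈ s, h i * c i := by
  have hz : ∀ i ∈ s, (((w i % h i).toNat : ℕ) : ℤ) = w i % h i := fun i hi =>
    Int.toNat_of_nonneg (Int.emod_nonneg _ (hh i hi).ne')
  have hle : ∑ i ∈ s, (((w i % h i).toNat : ℕ) : ℤ) * c i ≤ ∑ i ∈ s, h i * c i :=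
    sum_le_sum fun i hi => by
      rw [hz i hi]
      exact mul_le_mul_of_nonneg_right (Int.emod_lt_of_pos _ (hh i hi)).le (hc i hi)
  -- Reducing w i modulo h i changes the sum by a multiple of h i * c i, hence of B; `ht` then makes
  -- the quotient nonnegative.
  have hd : B ∣ ∑ i ∈ s, w i * c i + r * B - ∑ i ∈ s, (((w i % h i).toNat : ℕ) : ℤ) * c i := by
    rw [add_sub_right_comm, ← sum_sub_distrib]
    refine dvd_add (dvd_sum fun i hi => ?_) (dvd_mul_left _ _)
    rw [hz i hi]
    have : w i * c i - w i % h i * c i = w i / h i * (h i * c i) := by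
      have := Int.emod_add_mul_ediv (w i) (h i)
      linear_combination (-c i) * this
    rw [this]
    exact (hdvd i hi).mul_left _
  obtain ⟨k, hk⟩ := hd
  have hk0 : 0 ≤ k := by
    by_contra! hneg
    nlinarith [mul_neg_of_pos_of_neg hB hneg]
  refine ⟨fun i => (w i % h i).toNat, k.toNat, ?_, hle⟩
  rw [Int.toNat_of_nonneg hk0]
  linarith

/-! ### Representations with bounded interior part -/

/-- The data bounding the exceptional parts of the unions of sets of lengths: the extreme
generators, the least gaps `α`, `β` at both ends, the common difference `d`, and the multiplicities
`h i` at which interior generators can be exchanged for extreme ones. -/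
structure GapData (a : ι → ℤ) (i₀ i₁ : ι) (d α β : ℤ) (h : ι → ℤ) : Prop where
  pos : 0 < a i₀
  lt : a i₀ < a i₁
  α_pos : 0 < α
  β_pos : 0 < β
  left : ∀ i, i ≠ i₀ → α ≤ a i - a i₀
  right : ∀ i, i ≠ i₁ → β ≤ a i₁ - a i
  h_pos : ∀ i, 0 < h i
  dvd_h : ∀ i, a i₁ - a i₀ ∣ h i * (a i - a i₀)
  dvd : ∀ i, d ∣ a i - a i₀
  d_pos : 0 < d
  bezout : ∃ w : ι → ℤ, d = ∑ i, w i * (a i - a i₀)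
  coprime : IsCoprime d (a i₀)

/-- The indices of the generators other than the extreme ones. -/
def interior (i₀ i₁ : ι) : Finset ι := (univ.erase i₀).erase i₁

theorem sum_eq_interior (hne : i₁ ≠ i₀) (f : ι → ℤ) :
    ∑ i, f i = f i₀ + f i₁ + ∑ i ∈ interior i₀ i₁, f i := by
  rw [interior, add_assoc, add_sum_erase _ _ (mem_erase.2 ⟨hne, mem_univ _⟩),
    add_sum_erase _ _ (mem_univ _)]

theorem sum_ite_interior (z : ι → ℕ) (c : ι → ℤ) :
    ∑ i, ((if i ∈ interior i₀ i₁ then z i else 0 : ℕ) : ℤ) * c i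
      = ∑ i ∈ interior i₀ i₁, (z i : ℤ) * c i := by
  simp [sum_ite_mem]

variable {d α β : ℤ} {h : ι → ℤ}

/-- The threshold `∑ h_i (a_i - a_1)` over interior indices. -/
def leftBound (a : ι → ℤ) (i₀ i₁ : ι) (h : ι → ℤ) : ℤ :=
  ∑ i ∈ interior i₀ i₁, h i * (a i - a i₀)

/-- The threshold `∑ h_i (a_p - a_i)` over interior indices. -/
def rightBound (a : ι → ℤ) (i₀ i₁ : ι) (h : ι → ℤ) : ℤ :=
  ∑ i ∈ interior i₀ i₁, h i * (a i₁ - a i)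

namespace GapData

variable (H : GapData a i₀ i₁ d α β h)

include H

theorem ne : i₁ ≠ i₀ := fun e => by simpa [e] using H.lt

theorem left_nonneg (i : ι) : 0 ≤ a i - a i₀ := by
  by_cases hi : i = i₀
  · simp [hi]
  · exact H.α_pos.le.trans (H.left i hi)

theorem right_nonneg (i : ι) : 0 ≤ a i₁ - a i := by
  by_cases hi : i = i₁
  · simp [hi]
  · exact H.β_pos.le.trans (H.right i hi)

theorem dvd_right (i : ι) : d ∣ a i₁ - a i := by
  have := dvd_sub (H.dvd i₁) (H.dvd i)
  rwa [sub_sub_sub_cancel_right] at this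

theorem dvd_of_isGapSum {t : ℤ} (ht : IsGapSum a i₀ i₁ t) : d ∣ t := by
  obtain ⟨x, y, rfl⟩ := ht
  exact dvd_add (dvd_sum fun i _ => (H.dvd_right i).mul_left _)
    (dvd_sum fun i _ => (H.dvd i).mul_left _)

theorem nonneg_of_isGapSum {t : ℤ} (ht : IsGapSum a i₀ i₁ t) : 0 ≤ t := by
  obtain ⟨x, y, rfl⟩ := ht
  exact add_nonneg (sum_nonneg fun i _ => mul_nonneg (Int.natCast_nonneg _) (H.right_nonneg i))
    (sum_nonneg fun i _ => mul_nonneg (Int.natCast_nonneg _) (H.left_nonneg i))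

theorem exists_left_rep {t : ℤ} (hd : d ∣ t) (ht : leftBound a i₀ i₁ h ≤ t) :
    ∃ (z : ι → ℕ) (q : ℕ),
      t = ∑ i ∈ interior i₀ i₁, (z i : ℤ) * (a i - a i₀) + q * (a i₁ - a i₀) ∧
        ∑ i ∈ interior i₀ i₁, (z i : ℤ) * (a i - a i₀) ≤ leftBound a i₀ i₁ h := by
  obtain ⟨w, hw⟩ := H.bezout
  obtain ⟨k, rfl⟩ := hd
  have e : d * k = ∑ i ∈ interior i₀ i₁, (k * w i) * (a i - a i₀)
      + (k * w i₁) * (a i₁ - a i₀) := by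
    rw [hw, sum_eq_interior H.ne]
    simp only [mul_assoc, ← mul_sum]
    ring
  rw [e] at ht ⊢
  exact exists_reduced_coeffs (sub_pos.2 H.lt) (fun i _ => H.left_nonneg i)
    (fun i _ => H.h_pos i) (fun i _ => H.dvd_h i) ht

theorem exists_right_rep {t : ℤ} (hd : d ∣ t) (ht : rightBound a i₀ i₁ h ≤ t) :
    ∃ (z : ι → ℕ) (q : ℕ),
      t = ∑ i ∈ interior i₀ i₁, (z i : ℤ) * (a i₁ - a i) + q * (a i₁ - a i₀) ∧
        ∑ i ∈ interior i₀ i₁, (z i : ℤ) * (a i₁ - a i) ≤ rightBound a i₀ i₁ h := by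
  obtain ⟨w, hw⟩ := H.bezout
  obtain ⟨k, rfl⟩ := hd
  -- The Bézout relation for left gaps becomes one for right gaps through a i - a i₀ = (a i₁ - a i₀)
  -- - (a i₁ - a i).
  have e : d * k = ∑ i ∈ interior i₀ i₁, (-(k * w i)) * (a i₁ - a i)
      + (k * w i₁ + ∑ i ∈ interior i₀ i₁, k * w i) * (a i₁ - a i₀) := by
    have e' : ∑ i ∈ interior i₀ i₁, (-(k * w i)) * (a i₁ - a i)
        + ∑ i ∈ interior i₀ i₁, k * w i * (a i₁ - a i₀)
        = k * ∑ i ∈ interior i₀ i₁, w i * (a i - a i₀) := by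
      rw [mul_sum, ← sum_add_distrib]
      exact sum_congr rfl fun i _ => by ring
    rw [hw, sum_eq_interior H.ne, add_mul (k * w i₁), sum_mul]
    linear_combination -e'
  rw [e] at ht ⊢
  refine exists_reduced_coeffs (sub_pos.2 H.lt) (fun i _ => H.right_nonneg i)
    (fun i _ => H.h_pos i) (fun i _ => ?_) ht
  have := (Dvd.intro_left (h i) rfl).sub (H.dvd_h i)
  rwa [← mul_sub, sub_sub_sub_cancel_right] at this

theorem mul_sum_le_right (z : ι → ℕ) (s : Finset ι) (hs : i₁ ∉ s) :
    β * ((∑ i ∈ s, z i : ℕ) : ℤ) ≤ ∑ i ∈ s, (z i : ℤ) * (a i₁ - a i) := by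
  push_cast
  rw [mul_sum]
  refine sum_le_sum fun i hi => ?_
  rw [mul_comm]
  exact mul_le_mul_of_nonneg_left (H.right i fun e => hs (e ▸ hi)) (Int.natCast_nonneg _)

theorem mul_sum_le_left (z : ι → ℕ) (s : Finset ι) (hs : i₀ ∉ s) :
    α * ((∑ i ∈ s, z i : ℕ) : ℤ) ≤ ∑ i ∈ s, (z i : ℤ) * (a i - a i₀) := by
  push_cast
  rw [mul_sum]
  refine sum_le_sum fun i hi => ?_
  rw [mul_comm]
  exact mul_le_mul_of_nonneg_left (H.left i fun e => hs (e ▸ hi)) (Int.natCast_nonneg _)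

/-- Beyond the left threshold, every admissible pair of lengths occurs. -/
theorem commonLengths_of_leftBound_le {u v : ℕ} (huv : u ≤ v)
    (hv : leftBound a i₀ i₁ h ≤ α * v) (hd : d ∣ a i₁ * u - a i₀ * v)
    (ht : leftBound a i₀ i₁ h ≤ a i₁ * u - a i₀ * v) : CommonLengths a u v := by
  obtain ⟨z, q, hz, hzle⟩ := H.exists_left_rep hd ht
  have huv' : (u : ℤ) ≤ v := by exact_mod_cast huv
  have hB := sub_pos.2 H.lt
  have hz0 : 0 ≤ ∑ i ∈ interior i₀ i₁, (z i : ℤ) * (a i - a i₀) :=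
    sum_nonneg fun i _ => mul_nonneg (Int.natCast_nonneg _) (H.left_nonneg i)
  -- Because u ≤ v, the value a i₁ * u - a i₀ * v is at most u * (a i₁ - a i₀).
  have hq : q ≤ u := by
    have : (q : ℤ) * (a i₁ - a i₀) ≤ u * (a i₁ - a i₀) := by
      nlinarith [mul_le_mul_of_nonneg_left huv' H.pos.le]
    exact_mod_cast le_of_mul_le_mul_right this hB
  have hzv : ∑ i ∈ interior i₀ i₁, z i ≤ v := by
    have := (H.mul_sum_le_left z (interior i₀ i₁) (by simp [interior])).trans (hzle.trans hv)
    exact_mod_cast le_of_mul_le_mul_left this H.α_pos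
  -- The full gap a i₁ - a i₀ is both the right gap of i₀ and the left gap of i₁. Charging it to x
  -- keeps the bound on y for the interior coefficients alone.
  refine commonLengths_of_eq (i₀ := i₀) (i₁ := i₁) (x := Pi.single i₀ q)
    (y := fun i => if i ∈ interior i₀ i₁ then z i else 0) ?_ ?_ ?_
  · exact (sum_le_sum_of_subset (erase_subset _ _)).trans (by simpa using hq)
  · refine (sum_le_sum_of_subset (erase_subset _ _)).trans ?_
    simpa [sum_ite_mem] using hzv
  · rw [sum_ite_interior, hz, sum_eq_single (f := fun i => ((Pi.single i₀ q : ι → ℕ) i : ℤ) * _) i₀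
      (fun i _ hi => by simp [hi]) (by simp)]
    simp [add_comm]

/-- Beyond the right threshold, every admissible pair of lengths occurs. -/
theorem commonLengths_of_rightBound_le {u v : ℕ} (huv : u ≤ v)
    (hu : rightBound a i₀ i₁ h ≤ β * u) (hd : d ∣ a i₁ * u - a i₀ * v)
    (ht : rightBound a i₀ i₁ h ≤ a i₁ * u - a i₀ * v) : CommonLengths a u v := by
  obtain ⟨z, q, hz, hzle⟩ := H.exists_right_rep hd ht
  have huv' : (u : ℤ) ≤ v := by exact_mod_cast huv
  have hB := sub_pos.2 H.lt
  have hz0 : 0 ≤ ∑ i ∈ interior i₀ i₁, (z i : ℤ) * (a i₁ - a i) :=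
    sum_nonneg fun i _ => mul_nonneg (Int.natCast_nonneg _) (H.right_nonneg i)
  have hq : q ≤ u := by
    have : (q : ℤ) * (a i₁ - a i₀) ≤ u * (a i₁ - a i₀) := by
      nlinarith [mul_le_mul_of_nonneg_left huv' H.pos.le]
    exact_mod_cast le_of_mul_le_mul_right this hB
  have hzu : ∑ i ∈ interior i₀ i₁, z i ≤ u := by
    have := (H.mul_sum_le_right z (interior i₀ i₁) (by simp [interior])).trans (hzle.trans hu)
    exact_mod_cast le_of_mul_le_mul_left this H.β_pos
  refine commonLengths_of_eq (i₀ := i₀) (i₁ := i₁) (y := Pi.single i₁ q)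
    (x := fun i => if i ∈ interior i₀ i₁ then z i else 0) ?_ ?_ ?_
  · refine (sum_le_sum_of_subset (erase_subset _ _)).trans ?_
    simpa [sum_ite_mem] using hzu
  · exact (sum_le_sum_of_subset (erase_subset _ _)).trans (by simpa using hq.trans huv)
  · rw [sum_ite_interior, hz, sum_eq_single (f := fun i => ((Pi.single i₁ q : ι → ℕ) i : ℤ) * _) i₁
      (fun i _ hi => by simp [hi]) (by simp)]
    simp

/-- For small values a sum of distances automatically has few terms. -/
theorem commonLengths_of_isGapSum_of_le {u v : ℕ} (hu : a i₁ * u - a i₀ * v ≤ β * u)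
    (hv : a i₁ * u - a i₀ * v ≤ α * v) (ht : IsGapSum a i₀ i₁ (a i₁ * u - a i₀ * v)) :
    CommonLengths a u v := by
  obtain ⟨x, y, hxy⟩ := ht
  have h1 := (H.mul_sum_le_right x (univ.erase i₁) (by simp)).trans
    (sum_le_sum_of_subset_of_nonneg (erase_subset _ univ) fun i _ _ =>
      mul_nonneg (Int.natCast_nonneg _) (H.right_nonneg i))
  have h2 := (H.mul_sum_le_left y (univ.erase i₀) (by simp)).trans
    (sum_le_sum_of_subset_of_nonneg (erase_subset _ univ) fun i _ _ =>
      mul_nonneg (Int.natCast_nonneg _) (H.left_nonneg i))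
  have hx0 : 0 ≤ ∑ i, (x i : ℤ) * (a i₁ - a i) :=
    sum_nonneg fun i _ => mul_nonneg (Int.natCast_nonneg _) (H.right_nonneg i)
  have hy0 : 0 ≤ ∑ i, (y i : ℤ) * (a i - a i₀) :=
    sum_nonneg fun i _ => mul_nonneg (Int.natCast_nonneg _) (H.left_nonneg i)
  refine commonLengths_of_eq ?_ ?_ hxy
  · have := h1.trans (by linarith : _ ≤ β * u)
    exact_mod_cast le_of_mul_le_mul_left this H.β_pos
  · have := h2.trans (by linarith : _ ≤ α * v)
    exact_mod_cast le_of_mul_le_mul_left this H.α_pos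

/-- For a large longer length, common lengths are characterized by a single monoid. -/
theorem commonLengths_iff {u v : ℕ} (huv : u ≤ v) (hv : leftBound a i₀ i₁ h ≤ α * v)
    (hv' : (a i₁ - β) * rightBound a i₀ i₁ h ≤ β * a i₀ * v) :
    CommonLengths a u v ↔ IsGapSum a i₀ i₁ (a i₁ * u - a i₀ * v) := by
  refine ⟨fun h => h.isGapSum, fun ht => ?_⟩
  have hd := H.dvd_of_isGapSum ht
  have hβ : 0 ≤ a i₁ - β := by linarith [H.right i₀ H.ne.symm, H.pos]
  have hZ : 0 < a i₁ := H.pos.trans H.lt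
  -- This transfers the largeness of v to u: a i₁ * k ≤ β * (k + a i₀ * v) ≤ β * a i₁ * u. It is
  -- used with k the right threshold, and with k the value itself.
  have aux : ∀ k : ℤ, k ≤ rightBound a i₀ i₁ h → k ≤ a i₁ * u - a i₀ * v → k ≤ β * u := by
    intro k hk hkt
    have h1 : (a i₁ - β) * k ≤ β * a i₀ * v := (mul_le_mul_of_nonneg_left hk hβ).trans hv'
    have h2 : β * (k + a i₀ * v) ≤ β * (a i₁ * u) :=
      mul_le_mul_of_nonneg_left (by linarith) H.β_pos.le
    exact le_of_mul_le_mul_left (by linarith : a i₁ * k ≤ a i₁ * (β * u)) hZ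
  rcases le_total (leftBound a i₀ i₁ h) (a i₁ * u - a i₀ * v) with h1 | h1
  · exact H.commonLengths_of_leftBound_le huv hv hd h1
  rcases le_total (rightBound a i₀ i₁ h) (a i₁ * u - a i₀ * v) with h2 | h2
  · exact H.commonLengths_of_rightBound_le huv (aux _ le_rfl h2) hd h2
  · exact H.commonLengths_of_isGapSum_of_le (aux _ h2 le_rfl) (h1.trans hv) ht

theorem dvd_of_dvd_sub {u v : ℕ} (huv : d ∣ (u : ℤ) - v) : d ∣ a i₁ * u - a i₀ * v := by
  have := dvd_add ((H.dvd i₁).mul_right (u : ℤ)) (huv.mul_left (a i₀))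
  rwa [show (a i₁ - a i₀) * (u : ℤ) + a i₀ * (u - v) = a i₁ * u - a i₀ * v by ring] at this

/-- Modulo d all generators agree with a i₀, which is invertible there. -/
theorem dvd_sub_of_commonLengths {u v : ℕ} (huv : CommonLengths a u v) : d ∣ (u : ℤ) - v := by
  have h1 := H.dvd_of_isGapSum (huv.isGapSum (i₀ := i₀) (i₁ := i₁))
  have h2 : d ∣ a i₀ * ((u : ℤ) - v) := by
    have := dvd_sub h1 ((H.dvd i₁).mul_right (u : ℤ))
    rwa [show a i₁ * (u : ℤ) - a i₀ * v - (a i₁ - a i₀) * u = a i₀ * (u - v) by ring] at this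
  exact H.coprime.dvd_of_dvd_mul_left h2

end GapData

end Exchange

/-! ### Differences of a stretched set -/

/-- If `Y` arises from `X` by moving the parts of `X` below and above `n` apart and filling the gap
with an arithmetic progression whose difference `d` is already in `Δ X`, then `Δ Y = Δ X`. -/
theorem delta_eq_of_stretch {X Y : Set ℕ} {n d sL sU : ℕ} (hn : n ∈ X) (hd : d ∈ delta X)
    (hlow : ∀ m ≤ n, m + sL ∈ Y ↔ m ∈ X) (hup : ∀ m, n ≤ m → (m + sU ∈ Y ↔ m ∈ X))
    (hle : ∀ k ∈ Y, sL ≤ k)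
    (hmid : ∀ l ∈ Y, n + sL ≤ l → l < n + sU → l + d ∈ Y ∧ ∀ k ∈ Y, ¬(l < k ∧ k < l + d)) :
    delta Y = delta X := by
  apply Set.Subset.antisymm
  · rintro e ⟨l, hl, l', hl', hlt, hno, rfl⟩
    rcases le_or_gt (n + sU) l with h1 | h1
    · refine ⟨l - sU, (hup _ (by omega)).1 (by rwa [Nat.sub_add_cancel (by omega)]),
        l + e - sU, (hup _ (by omega)).1 (by rwa [Nat.sub_add_cancel (by omega)]),
        by omega, fun k hk hkk => ?_, by omega⟩
      exact hno (k + sU) ((hup k (by omega)).2 hk) (by omega)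
    rcases le_or_gt (l + e) (n + sL) with h2 | h2
    · have h3 := hle l hl
      refine ⟨l - sL, (hlow _ (by omega)).1 (by rwa [Nat.sub_add_cancel (by omega)]),
        l + e - sL, (hlow _ (by omega)).1 (by rwa [Nat.sub_add_cancel (by omega)]),
        by omega, fun k hk hkk => ?_, by omega⟩
      exact hno (k + sL) ((hlow k (by omega)).2 hk) (by omega)
    -- The point n + sL belongs to Y, so no pair of consecutive elements straddles it; the remaining
    -- pair starts in the middle range, where the next element is l + d.
    have h3 : n + sL ≤ l := by
      by_contra! h
      exact hno _ ((hlow n le_rfl).2 hn) ⟨h, h2⟩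
    obtain ⟨h4, h5⟩ := hmid l hl h3 h1
    have h6 : 0 < d := by
      obtain ⟨x, -, y, -, hxy, -, rfl⟩ := hd
      omega
    have h7 := hno _ h4
    have h8 := h5 _ hl'
    have : e = d := by omega
    rwa [this]
  · rintro e ⟨l, hl, l', hl', hlt, hno, rfl⟩
    rcases le_or_gt n l with h1 | h1
    · refine ⟨l + sU, (hup _ h1).2 hl, l + e + sU, (hup _ (by omega)).2 hl', by omega,
        fun k hk hkk => ?_, by omega⟩
      exact hno (k - sU) ((hup _ (by omega)).1 (by rwa [Nat.sub_add_cancel (by omega)])) (by omega)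
    · have h2 : l + e ≤ n := by
        by_contra! h
        exact hno _ hn ⟨h1, h⟩
      refine ⟨l + sL, (hlow _ h1.le).2 hl, l + e + sL, (hlow _ h2).2 hl', by omega,
        fun k hk hkk => ?_, by omega⟩
      exact hno (k - sL) ((hlow _ (by omega)).1 (by rwa [Nat.sub_add_cancel (by omega)])) (by omega)

/-! ### Invariance of the differences for large lengths -/

section Exchange

variable {ι : Type*} [Fintype ι] [DecidableEq ι] {a : ι → ℤ} {i₀ i₁ : ι} {d : ℕ} {α β : ℤ}
  {h : ι → ℤ}

/-- `n` is large enough for the unions of sets of lengths to have their asymptotic shape. -/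
structure LargeLength (a : ι → ℤ) (i₀ i₁ : ι) (d α β : ℤ) (h : ι → ℤ) (n : ℕ) : Prop where
  left : leftBound a i₀ i₁ h ≤ α * n
  right : (a i₁ - β) * rightBound a i₀ i₁ h ≤ β * a i₀ * n
  step : leftBound a i₀ i₁ h + a i₀ * d ≤ (a i₁ - a i₀) * n

namespace GapData

variable (H : GapData a i₀ i₁ d α β h)

include H

theorem largeLength_mono {n m : ℕ} (hn : LargeLength a i₀ i₁ d α β h n) (hnm : n ≤ m) :
    LargeLength a i₀ i₁ d α β h m := by
  have hnm' : (n : ℤ) ≤ m := by exact_mod_cast hnm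
  exact ⟨hn.left.trans (mul_le_mul_of_nonneg_left hnm' H.α_pos.le),
    hn.right.trans (mul_le_mul_of_nonneg_left hnm' (mul_pos H.β_pos H.pos).le),
    hn.step.trans (mul_le_mul_of_nonneg_left hnm' (sub_pos.2 H.lt).le)⟩

theorem commonLengths_iff_of_le {n m : ℕ} (hn : LargeLength a i₀ i₁ d α β h n) (hnm : n ≤ m) :
    CommonLengths a n m ↔ IsGapSum a i₀ i₁ (a i₁ * n - a i₀ * m) :=
  H.commonLengths_iff hnm (H.largeLength_mono hn hnm).left (H.largeLength_mono hn hnm).right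

theorem commonLengths_iff_of_ge {n m : ℕ} (hn : LargeLength a i₀ i₁ d α β h n) (hnm : m ≤ n) :
    CommonLengths a n m ↔ IsGapSum a i₀ i₁ (a i₁ * m - a i₀ * n) := by
  rw [← H.commonLengths_iff hnm hn.left hn.right]
  exact ⟨CommonLengths.symm, CommonLengths.symm⟩

/-- The witnesses are n and n + d: the field `step` puts their value above the left threshold, and
congruence modulo d excludes anything in between. -/
theorem mem_delta {n : ℕ} (hn : LargeLength a i₀ i₁ d α β h n) :
    d ∈ delta {m | CommonLengths a n m} := by
  have hd : 0 < d := by exact_mod_cast H.d_pos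
  have : Nonempty ι := ⟨i₀⟩
  refine ⟨n, CommonLengths.refl n, n + d, ?_, by omega, fun k hk hkk => ?_, rfl⟩
  · have := hn.step
    refine H.commonLengths_of_leftBound_le (by omega)
      (H.largeLength_mono hn (Nat.le_add_right n d)).left
      (H.dvd_of_dvd_sub (by simp)) ?_
    push_cast
    linarith
  · have h1 := H.dvd_sub_of_commonLengths hk
    rw [dvd_sub_comm] at h1
    have := Int.le_of_dvd (by omega) h1
    omega

/-- The set of differences of the set of lengths sharing an element with `n` is invariant under
translating `n` by a common multiple of the extreme generators. -/
theorem delta_add {n δ sL sU : ℕ} (hn : LargeLength a i₀ i₁ d α β h n)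
    (hL : a i₁ * sL = a i₀ * δ) (hU : a i₀ * sU = a i₁ * δ) :
    delta {m | CommonLengths a (n + δ) m} = delta {m | CommonLengths a n m} := by
  have hA := H.pos
  have hZ : 0 < a i₁ := H.pos.trans H.lt
  have hd0 : 0 < (d : ℤ) := H.d_pos
  have hLδ : sL ≤ δ := by
    have : a i₁ * (sL : ℤ) ≤ a i₁ * δ := by
      rw [hL]
      exact mul_le_mul_of_nonneg_right H.lt.le (Int.natCast_nonneg _)
    exact_mod_cast le_of_mul_le_mul_left this hZ
  have hUδ : δ ≤ sU := by
    have : a i₀ * (δ : ℤ) ≤ a i₀ * sU := by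
      rw [hU]
      exact mul_le_mul_of_nonneg_right H.lt.le (Int.natCast_nonneg _)
    exact_mod_cast le_of_mul_le_mul_left this hA
  have hn' := H.largeLength_mono hn (Nat.le_add_right n δ)
  have : Nonempty ι := ⟨i₀⟩
  have hlow : ∀ m ≤ n, CommonLengths a (n + δ) (m + sL) ↔ CommonLengths a n m := by
    intro m hm
    rw [H.commonLengths_iff_of_ge hn hm, H.commonLengths_iff_of_ge hn' (by omega)]
    rw [show a i₁ * ((m + sL : ℕ) : ℤ) - a i₀ * ((n + δ : ℕ) : ℤ) = a i₁ * m - a i₀ * n by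
      push_cast; linear_combination hL]
  have hup : ∀ m, n ≤ m → (CommonLengths a (n + δ) (m + sU) ↔ CommonLengths a n m) := by
    intro m hm
    rw [H.commonLengths_iff_of_le hn hm, H.commonLengths_iff_of_le hn' (by omega)]
    rw [show a i₁ * ((n + δ : ℕ) : ℤ) - a i₀ * ((m + sU : ℕ) : ℤ) = a i₁ * n - a i₀ * m by
      push_cast; linear_combination -hU]
  have hstep : leftBound a i₀ i₁ h ≤ (a i₁ - a i₀) * n := by
    have := hn.step
    have := mul_pos hA hd0
    linarith
  refine delta_eq_of_stretch (sL := sL) (sU := sU) (CommonLengths.refl n) (H.mem_delta hn) hlow hup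
    (fun k hk => ?_) (fun l hl h1 h2 => ?_)
  · rcases le_or_gt k (n + δ) with hk' | hk'
    · have h0 := H.nonneg_of_isGapSum ((H.commonLengths_iff_of_ge hn' hk').1 hk)
      push_cast at h0
      have h1 : a i₁ * (sL : ℤ) ≤ a i₁ * k := by
        have := mul_nonneg hA.le (Int.natCast_nonneg n)
        linarith
      exact_mod_cast le_of_mul_le_mul_left h1 hZ
    · omega
  · have hdl := H.dvd_sub_of_commonLengths hl
    have hdU := H.dvd_sub_of_commonLengths ((hup n le_rfl).2 (CommonLengths.refl n))
    -- Both l and n + sU are congruent to n + δ modulo d, so a step of d from l cannot jump over n +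
    -- sU.
    have hle : l + d ≤ n + sU := by
      have h3 : (d : ℤ) ∣ ((n + sU : ℕ) : ℤ) - l := by
        have := dvd_sub hdl hdU
        rwa [sub_sub_sub_cancel_left] at this
      have := Int.le_of_dvd (by omega) h3
      omega
    have hdl' : (d : ℤ) ∣ ((n + δ : ℕ) : ℤ) - ((l + d : ℕ) : ℤ) := by
      have := dvd_sub hdl (dvd_refl (d : ℤ))
      rwa [sub_sub, ← Nat.cast_add] at this
    refine ⟨?_, fun k hk hkk => ?_⟩
    · have hle' : ((l + d : ℕ) : ℤ) ≤ n + sU := by exact_mod_cast hle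
      have h1' : (n + sL : ℤ) ≤ ((l + d : ℕ) : ℤ) := by exact_mod_cast h1.trans (by omega)
      -- On either side of n + δ the value is smallest at the end of the middle range, n + sU or n +
      -- sL, where it equals (a i₁ - a i₀) * n.
      rcases le_total (n + δ) (l + d) with h3 | h3
      · refine H.commonLengths_of_leftBound_le h3 (H.largeLength_mono hn' h3).left
          (H.dvd_of_dvd_sub hdl') (hstep.trans ?_)
        have := mul_le_mul_of_nonneg_left hle' hA.le
        push_cast at this ⊢
        linarith
      · refine CommonLengths.symm (H.commonLengths_of_leftBound_le h3 hn'.left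
          (H.dvd_of_dvd_sub ((dvd_sub_comm).1 hdl')) (hstep.trans ?_))
        have := mul_le_mul_of_nonneg_left h1' hZ.le
        push_cast at this ⊢
        linarith
    · have h3 : (d : ℤ) ∣ (k : ℤ) - l := by
        simpa using dvd_sub hdl (H.dvd_sub_of_commonLengths hk)
      have := Int.le_of_dvd (by omega) h3
      omega

end GapData

end Exchange

/-! ### Arithmetic of the generators of the semigroup -/

theorem natCast_finset_gcd_mem {κ : Type*} (I : Submodule ℤ ℤ) (s : Finset κ) (f : κ → ℕ)
    (hf : ∀ i ∈ s, (f i : ℤ) ∈ I) : ((s.gcd f : ℕ) : ℤ) ∈ I := by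
  classical
  induction s using Finset.induction_on with
  | empty => simp
  | insert i s _ ih =>
    rw [gcd_insert, gcd_eq_nat_gcd, Nat.gcd_eq_gcd_ab]
    exact I.add_mem (mul_comm _ (f i : ℤ) ▸ I.smul_mem _ (hf i (mem_insert_self _ _)))
      (mul_comm _ ((s.gcd f : ℕ) : ℤ) ▸ I.smul_mem _ (ih fun j hj => hf j (mem_insert_of_mem hj)))

section Generators

variable {p : ℕ} {a : Fin p → ℕ}

theorem gen_eq {j : ℕ} (i : Fin p) (h : j = i + 1) : gen a j = a i := by
  subst h
  rw [gen, dif_pos ⟨by omega, by omega⟩]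
  rfl

theorem gen_lt_gen (hmono : StrictMono a) {i j : ℕ} (hi : 1 ≤ i) (hij : i < j) (hj : j ≤ p) :
    gen a i < gen a j := by
  rw [gen_eq ⟨i - 1, by omega⟩ (by simp; omega), gen_eq ⟨j - 1, by omega⟩ (by simp; omega)]
  exact hmono (by simp [Fin.lt_def]; omega)

theorem gen_le_gen (hmono : StrictMono a) {i j : ℕ} (hi : 1 ≤ i) (hij : i ≤ j) (hj : j ≤ p) :
    gen a i ≤ gen a j := by
  rcases hij.eq_or_lt with rfl | h
  · rfl
  · exact (gen_lt_gen hmono hi h hj).le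

theorem dGcd_dvd_gen_sub (hmono : StrictMono a) {j : ℕ} (hj : 1 ≤ j) (hjp : j ≤ p) :
    (dGcd a : ℤ) ∣ (gen a j : ℤ) - gen a 1 := by
  induction j, hj using Nat.le_induction with
  | base => simp
  | succ j hj ih =>
    have h1 : dGcd a ∣ gen a (j + 1) - gen a j :=
      Finset.gcd_dvd (f := fun i => gen a (i + 1) - gen a i) (mem_Icc.2 ⟨hj, by omega⟩)
    have h2 := Int.natCast_dvd_natCast.2 h1
    rw [Nat.cast_sub (gen_lt_gen hmono hj (Nat.lt_succ_self j) hjp).le] at h2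
    have := dvd_add h2 (ih (by omega))
    rwa [sub_add_sub_cancel] at this

theorem exists_dGcd_eq_sum (hmono : StrictMono a) :
    ∃ w : Fin p → ℤ, (dGcd a : ℤ) = ∑ i, w i * ((a i : ℤ) - gen a 1) := by
  have h : (dGcd a : ℤ) ∈ Submodule.span ℤ (Set.range fun i => (a i : ℤ) - gen a 1) := by
    refine natCast_finset_gcd_mem _ _ _ fun i hi => ?_
    rw [mem_Icc] at hi
    rw [Nat.cast_sub (gen_lt_gen hmono hi.1 (Nat.lt_succ_self i) (by omega)).le,
      ← sub_sub_sub_cancel_right _ _ (gen a 1 : ℤ)]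
    refine Submodule.sub_mem _ (Submodule.subset_span ⟨⟨i, by omega⟩, ?_⟩)
      (Submodule.subset_span ⟨⟨i - 1, by omega⟩, ?_⟩)
    · rw [gen_eq ⟨i, by omega⟩ rfl]
    · rw [gen_eq (j := i) ⟨i - 1, by omega⟩ (by simp; omega)]
  obtain ⟨c, hc⟩ := (Submodule.mem_span_range_iff_exists_fun ℤ).1 h
  exact ⟨c, by simpa using hc.symm⟩

/-- A cofinite S contains two consecutive integers, and g divides both. -/
theorem eq_one_of_forall_dvd {S : AddSubmonoid ℕ} (hS : IsNumericalSemigroup S)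
    (hgen : AddSubmonoid.closure (Set.range a) = S) {g : ℕ} (hg : ∀ i, g ∣ a i) : g = 1 := by
  have hdvd : ∀ s ∈ S, g ∣ s := by
    rw [← hgen]
    intro s hs
    induction hs using AddSubmonoid.closure_induction with
    | mem x hx =>
      obtain ⟨i, rfl⟩ := hx
      exact hg i
    | zero => exact dvd_zero g
    | add x y _ _ hx hy => exact dvd_add hx hy
  obtain ⟨N, hN⟩ := hS.bddAbove
  have hmem : ∀ n, N < n → n ∈ S := fun n hn => by
    by_contra h
    exact absurd (hN h) (by omega)
  have h1 := hdvd _ (hmem (N + 1) (by omega))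
  have h2 := hdvd _ (hmem (N + 1 + 1) (by omega))
  exact Nat.dvd_one.1 ((Nat.dvd_add_right h1).1 h2)

theorem nu_eq {S : AddSubmonoid ℕ} (hgen : AddSubmonoid.closure (Set.range a) = S) (n : ℕ) :
    nu S a n = {m | CommonLengths (fun i => (a i : ℤ)) n m} := by
  ext m
  simp only [nu, W, lengths, factorizations, len, Set.mem_iUnion, Set.mem_ofPred_eq, Set.mem_image,
    exists_prop, CommonLengths]
  constructor
  · rintro ⟨s, ⟨-, x, hx, hxn⟩, y, hy, hym⟩
    exact ⟨x, y, hxn, hym, by exact_mod_cast hx.trans hy.symm⟩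
  · rintro ⟨x, y, hx, hy, hxy⟩
    refine ⟨∑ i, x i * a i, ⟨?_, x, rfl, hx⟩, y, ?_, hy⟩
    · rw [← hgen]
      refine sum_mem fun i _ => ?_
      rw [← smul_eq_mul]
      exact nsmul_mem (AddSubmonoid.subset_closure (Set.mem_range_self i)) _
    · exact_mod_cast hxy.symm

/-- The multiplicity at which the generator `a_i` can be exchanged for extreme generators. -/
def exchangeMult (a : Fin p → ℕ) (i : Fin p) : ℤ :=
  ((gen a p : ℤ) - gen a 1) / gGcd a (i + 1)

theorem gGcd_dvd_gen_sub (i : ℕ) : (gGcd a i : ℤ) ∣ (gen a i : ℤ) - gen a 1 :=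
  Int.natCast_dvd.2 (Nat.gcd_dvd_left _ _)

theorem gGcd_dvd_sub (i : ℕ) : (gGcd a i : ℤ) ∣ (gen a p : ℤ) - gen a 1 := by
  rw [dvd_sub_comm]
  exact Int.natCast_dvd.2 ((Nat.gcd_dvd_right _ _).trans (Nat.gcd_dvd_left _ _))

variable (hp : 2 ≤ p) (hpos : ∀ i, 0 < a i) (hmono : StrictMono a)

include hp hmono in
theorem gGcd_pos (i : ℕ) : 0 < gGcd a i := by
  refine Nat.gcd_pos_of_pos_right _ (Nat.gcd_pos_of_pos_left _ (Int.natAbs_pos.2 ?_))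
  have := gen_lt_gen hmono le_rfl hp le_rfl
  omega

theorem exchangeMult_mul_gGcd (i : Fin p) :
    exchangeMult a i * gGcd a (i + 1) = (gen a p : ℤ) - gen a 1 :=
  Int.ediv_mul_cancel (gGcd_dvd_sub _)

include hp hmono in
theorem exchangeMult_pos (i : Fin p) : 0 < exchangeMult a i := by
  have h1 := exchangeMult_mul_gGcd (a := a) i
  have h2 := gGcd_pos hp hmono (i + 1)
  have h3 := gen_lt_gen hmono le_rfl hp le_rfl
  refine pos_of_mul_pos_left (b := (gGcd a (i + 1) : ℤ)) ?_ (Int.natCast_nonneg _)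
  omega

include hp hpos hmono in
theorem gapData {S : AddSubmonoid ℕ} (hS : IsNumericalSemigroup S)
    (hgen : AddSubmonoid.closure (Set.range a) = S) :
    GapData (fun i => (a i : ℤ)) ⟨0, by omega⟩ ⟨p - 1, by omega⟩ (dGcd a)
      ((gen a 2 : ℤ) - gen a 1) ((gen a p : ℤ) - gen a (p - 1)) (exchangeMult a) := by
  have e0 : a ⟨0, by omega⟩ = gen a 1 := (gen_eq _ rfl).symm
  have e1 : a ⟨p - 1, by omega⟩ = gen a p := (gen_eq _ (by simp; omega)).symm
  have ei : ∀ i : Fin p, a i = gen a (i + 1) := fun i => (gen_eq i rfl).symm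
  have hdvd : ∀ i, (dGcd a : ℤ) ∣ (a i : ℤ) - gen a 1 := fun i => by
    rw [ei]
    exact dGcd_dvd_gen_sub hmono (by omega) (by omega)
  have hlt := gen_lt_gen hmono le_rfl hp le_rfl
  refine ⟨?_, ?_, ?_, ?_, ?_, ?_, exchangeMult_pos hp hmono, ?_, ?_, ?_, ?_, ?_⟩
  · exact_mod_cast hpos _
  · simp only [e0, e1]
    exact_mod_cast hlt
  · have := gen_lt_gen hmono le_rfl (by omega : 1 < 2) hp
    omega
  · have := gen_lt_gen hmono (i := p - 1) (j := p) (by omega) (by omega) le_rfl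
    omega
  · intro i hi
    have : 0 < i.1 := Nat.pos_of_ne_zero fun h => hi (Fin.ext h)
    have := gen_le_gen hmono (i := 2) (j := i + 1) (by omega) (by omega) (by omega)
    simp only [e0, ei i]
    omega
  · intro i hi
    have : i.1 ≠ p - 1 := fun h => hi (Fin.ext h)
    have := gen_le_gen hmono (i := i + 1) (j := p - 1) (by omega) (by omega) (by omega)
    simp only [e1, ei i]
    omega
  · intro i
    simp only [e0, e1, ei i]
    rw [← exchangeMult_mul_gGcd i]
    exact mul_dvd_mul_left _ (gGcd_dvd_gen_sub _)
  · intro i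
    simp only [e0]
    exact hdvd i
  · have h1 := hdvd ⟨p - 1, by omega⟩
    rw [e1] at h1
    have : (dGcd a : ℤ) ≠ 0 := fun h => by
      rw [h, zero_dvd_iff] at h1
      omega
    omega
  · simp only [e0]
    exact exists_dGcd_eq_sum hmono
  · simp only [e0]
    -- A common divisor of d and a_1 divides every a_i - a_1, hence every generator.
    refine Nat.isCoprime_iff_coprime.2 (eq_one_of_forall_dvd hS hgen fun i => ?_)
    have h1 : ((Nat.gcd (dGcd a) (gen a 1) : ℕ) : ℤ) ∣ (a i : ℤ) - gen a 1 :=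
      (Int.natCast_dvd_natCast.2 (Nat.gcd_dvd_left _ _)).trans (hdvd i)
    have h2 : ((Nat.gcd (dGcd a) (gen a 1) : ℕ) : ℤ) ∣ gen a 1 :=
      Int.natCast_dvd_natCast.2 (Nat.gcd_dvd_right _ _)
    exact Int.natCast_dvd_natCast.1 (by simpa using dvd_add h1 h2)

-- With a single generator, an element determines its factorization, so ν(n) has no second length.
include hpos in
theorem deltaNu_eq_empty_of_subsingleton {S : AddSubmonoid ℕ} [Subsingleton (Fin p)]
    (hgen : AddSubmonoid.closure (Set.range a) = S) (n : ℕ) : deltaNu S a n = ∅ := by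
  have h : ∀ m ∈ nu S a n, m = n := by
    rw [nu_eq hgen]
    rintro m ⟨x, y, rfl, rfl, hxy⟩
    refine sum_congr rfl fun i _ => ?_
    rw [Fintype.sum_subsingleton _ i, Fintype.sum_subsingleton _ i] at hxy
    have : (a i : ℤ) ≠ 0 := by exact_mod_cast (hpos i).ne'
    exact_mod_cast (mul_right_cancel₀ this hxy).symm
  refine Set.eq_empty_of_forall_notMem fun e he => ?_
  obtain ⟨l, hl, l', hl', hlt, -⟩ := he
  rw [h l hl, h l' hl'] at hlt
  exact lt_irrefl _ hlt

include hp hpos hmono in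
theorem deltaNu_add_lcm {S : AddSubmonoid ℕ} (hS : IsNumericalSemigroup S)
    (hgen : AddSubmonoid.closure (Set.range a) = S) {n : ℕ}
    (hn : LargeLength (fun i => (a i : ℤ)) ⟨0, by omega⟩ ⟨p - 1, by omega⟩ (dGcd a)
      ((gen a 2 : ℤ) - gen a 1) ((gen a p : ℤ) - gen a (p - 1)) (exchangeMult a) n) :
    deltaNu S a (n + Nat.lcm (gen a 1) (gen a p)) = deltaNu S a n := by
  obtain ⟨r, hr⟩ := Nat.dvd_lcm_left (gen a 1) (gen a p)
  obtain ⟨q, hq⟩ := Nat.dvd_lcm_right (gen a 1) (gen a p)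
  have e0 : a ⟨0, by omega⟩ = gen a 1 := (gen_eq _ rfl).symm
  have e1 : a ⟨p - 1, by omega⟩ = gen a p := (gen_eq _ (by simp; omega)).symm
  rw [deltaNu, deltaNu, nu_eq hgen, nu_eq hgen]
  -- With δ = a_1 r = a_p q, these are the shifts a_1 δ / a_p and a_p δ / a_1.
  refine (gapData hp hpos hmono hS hgen).delta_add (sL := gen a 1 * q) (sU := gen a p * r) hn ?_ ?_
  · simp only [e0, e1]
    rw [hq]
    push_cast
    ring
  · simp only [e0, e1]
    rw [hr]
    push_cast
    ring

end Generators

/-! ### Thresholds for large lengths -/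

section Exchange

variable {ι : Type*} [Fintype ι] [DecidableEq ι] {a : ι → ℤ} {i₀ i₁ : ι} {d α β : ℤ}
  {h : ι → ℤ}

theorem GapData.leftBound_nonneg (H : GapData a i₀ i₁ d α β h) : 0 ≤ leftBound a i₀ i₁ h :=
  sum_nonneg fun i _ => mul_nonneg (H.h_pos i).le (H.left_nonneg i)

theorem GapData.rightBound_nonneg (H : GapData a i₀ i₁ d α β h) : 0 ≤ rightBound a i₀ i₁ h :=
  sum_nonneg fun i _ => mul_nonneg (H.h_pos i).le (H.right_nonneg i)

theorem GapData.exists_largeLength (H : GapData a i₀ i₁ d α β h) :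
    ∃ N : ℕ, ∀ n, N ≤ n → LargeLength a i₀ i₁ d α β h n := by
  have hL := H.leftBound_nonneg
  have hR := H.rightBound_nonneg
  have hβ : 0 ≤ a i₁ - β := by linarith [H.right i₀ H.ne.symm, H.pos]
  have hd := mul_pos H.pos H.d_pos
  have hR' := mul_nonneg hβ hR
  have key : ∀ {k n c : ℤ}, 0 ≤ n → 0 < c → k ≤ n → k ≤ c * n := fun hn hc hk => by nlinarith
  refine ⟨(leftBound a i₀ i₁ h + a i₀ * d + (a i₁ - β) * rightBound a i₀ i₁ h).toNat,
    fun n hn => ?_⟩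
  have hn' := Int.toNat_le.1 hn
  have hn0 := Int.natCast_nonneg n
  exact ⟨key hn0 H.α_pos (by linarith), key hn0 (mul_pos H.β_pos H.pos) (by linarith),
    key hn0 (sub_pos.2 H.lt) (by linarith)⟩

/-- Pointwise bounds on the interior terms suffice for `n` to be large. -/
theorem GapData.largeLength_of_forall (H : GapData a i₀ i₁ d α β h)
    (hne : (interior i₀ i₁).Nonempty) {n : ℕ}
    (hl : ∀ i ∈ interior i₀ i₁, (a i₀ + α) * (a i₀ * d
      + #(interior i₀ i₁) * (h i * (a i - a i₀))) ≤ α * a i₀ * n)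
    (hr : ∀ i ∈ interior i₀ i₁, (a i₁ - β) *
      (#(interior i₀ i₁) * (h i * (a i₁ - a i))) ≤ β * a i₀ * n) :
    LargeLength a i₀ i₁ d α β h n := by
  have hc : (0 : ℤ) < #(interior i₀ i₁) := by exact_mod_cast hne.card_pos
  have hα : 0 < a i₀ + α := add_pos H.pos H.α_pos
  have hL : (a i₀ + α) * (leftBound a i₀ i₁ h + a i₀ * d) ≤ α * a i₀ * n := by
    have := sum_le_sum hl
    rw [sum_const, nsmul_eq_mul, ← mul_sum, sum_add_distrib, sum_const, nsmul_eq_mul,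
      ← mul_sum, ← mul_add] at this
    change (a i₀ + α) * (_ * (_ + leftBound a i₀ i₁ h)) ≤ _ at this
    refine le_of_mul_le_mul_left (le_trans (le_of_eq ?_) this) hc
    ring
  have hR : (a i₁ - β) * rightBound a i₀ i₁ h ≤ β * a i₀ * n := by
    have := sum_le_sum hr
    rw [sum_const, nsmul_eq_mul, ← mul_sum, ← mul_sum] at this
    change (a i₁ - β) * (_ * rightBound a i₀ i₁ h) ≤ _ at this
    refine le_of_mul_le_mul_left (le_trans (le_of_eq ?_) this) hc
    ring
  have hd := mul_pos H.pos H.d_pos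
  have hn0 := Int.natCast_nonneg n
  have h1 : leftBound a i₀ i₁ h + a i₀ * d ≤ α * n := by
    -- The hypothesis gives slack here: α * a i₀ * n ≤ (a i₀ + α) * (α * n).
    refine le_of_mul_le_mul_left (hL.trans ?_) hα
    nlinarith [mul_nonneg (mul_nonneg H.α_pos.le H.α_pos.le) hn0]
  exact ⟨by linarith, hR, h1.trans (mul_le_mul_of_nonneg_right (H.left i₁ H.ne) hn0)⟩

end Exchange

/-! ### The explicit bound from S_i and S'_i -/

section Bound

variable {p : ℕ} {a : Fin p → ℕ} (hp : 3 ≤ p)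

theorem mem_interior_iff (i : Fin p) :
    i ∈ interior (⟨0, by omega⟩ : Fin p) ⟨p - 1, by omega⟩ ↔ 1 ≤ i.1 ∧ i.1 + 1 ≤ p - 1 := by
  simp only [interior, mem_erase, mem_univ, and_true, ne_eq, Fin.ext_iff]
  omega

theorem card_interior : #(interior (⟨0, by omega⟩ : Fin p) ⟨p - 1, by omega⟩) = p - 2 := by
  rw [interior, card_erase_of_mem, card_erase_of_mem (mem_univ _), card_univ, Fintype.card_fin]
  · omega
  · simp only [mem_erase, mem_univ, and_true, ne_eq, Fin.ext_iff]
    omega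

theorem boundS_le_NS {j : ℕ} (hj : j ∈ Icc 2 (p - 1)) : boundS a j ≤ NS a hp :=
  (le_max_left _ _).trans ((le_sup' (fun i => max (boundS a i) (boundS' a i)) hj).trans
    (Int.le_ceil _))

theorem boundS'_le_NS {j : ℕ} (hj : j ∈ Icc 2 (p - 1)) : boundS' a j ≤ NS a hp :=
  (le_max_right _ _).trans ((le_sup' (fun i => max (boundS a i) (boundS' a i)) hj).trans
    (Int.le_ceil _))

theorem largeLength_of_NS_le (hpos : ∀ i, 0 < a i) (hmono : StrictMono a) {S : AddSubmonoid ℕ}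
    (hS : IsNumericalSemigroup S) (hgen : AddSubmonoid.closure (Set.range a) = S) {n : ℕ}
    (hn : (NS a hp : ℚ) ≤ gen a 1 * n) :
    LargeLength (fun i => (a i : ℤ)) ⟨0, by omega⟩ ⟨p - 1, by omega⟩ (dGcd a)
      ((gen a 2 : ℤ) - gen a 1) ((gen a p : ℤ) - gen a (p - 1)) (exchangeMult a) n := by
  have e0 : a ⟨0, by omega⟩ = gen a 1 := (gen_eq _ rfl).symm
  have e1 : a ⟨p - 1, by omega⟩ = gen a p := (gen_eq _ (by simp; omega)).symm
  have ei : ∀ i : Fin p, a i = gen a (i + 1) := fun i => (gen_eq i rfl).symm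
  have hcard : ((#(interior (⟨0, by omega⟩ : Fin p) ⟨p - 1, by omega⟩) : ℕ) : ℤ) = (p : ℤ) - 2 := by
    rw [card_interior hp]
    omega
  have hne : (interior (⟨0, by omega⟩ : Fin p) ⟨p - 1, by omega⟩).Nonempty := by
    rw [← card_pos, card_interior hp]
    omega
  have hg : ∀ i : Fin p, (0 : ℚ) < gGcd a (i + 1) := fun i => by
    exact_mod_cast gGcd_pos (by omega) hmono _
  have hmul : ∀ i : Fin p,
      (exchangeMult a i : ℚ) * gGcd a (i + 1) = (gen a p : ℚ) - gen a 1 := fun i => by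
    exact_mod_cast exchangeMult_mul_gGcd i
  refine (gapData (by omega) hpos hmono hS hgen).largeLength_of_forall hne ?_ ?_
  · intro i hi
    rw [mem_interior_iff hp] at hi
    have h12 : (gen a 1 : ℚ) < gen a 2 := by
      exact_mod_cast gen_lt_gen hmono le_rfl (by omega) (by omega)
    have h := (boundS_le_NS (a := a) hp (mem_Icc.2 ⟨by omega, hi.2⟩ : i.1 + 1 ∈ _)).trans hn
    -- Substituting h_i = (a_p - a_1) / g_i cancels g_i and turns S_i into the integral expression
    -- of `largeLength_of_forall`, where a_1 + α = a_2.
    have e : boundS a (i + 1) = gen a 2 * (gen a 1 * dGcd a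
        + ((p : ℚ) - 2) * (exchangeMult a i * (gen a (i + 1) - gen a 1)))
        / (gen a 2 - gen a 1) := by
      rw [boundS, div_eq_div_iff (mul_neg_of_neg_of_pos (sub_neg.2 h12) (hg i)).ne
        (sub_pos.2 h12).ne']
      linear_combination ((gen a 2 : ℚ) * (p - 2) * (gen a (i + 1) - gen a 1) *
        (gen a 2 - gen a 1)) * hmul i
    rw [e, div_le_iff₀ (sub_pos.2 h12)] at h
    simp only [e0, ei i, hcard]
    have h' : (gen a 2 : ℤ) * (gen a 1 * dGcd a
        + ((p : ℤ) - 2) * (exchangeMult a i * (gen a (i + 1) - gen a 1)))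
        ≤ gen a 1 * n * (gen a 2 - gen a 1) := by exact_mod_cast h
    rw [add_sub_cancel]
    linarith
  · intro i hi
    rw [mem_interior_iff hp] at hi
    have h12 : (gen a (p - 1) : ℚ) < gen a p := by
      exact_mod_cast gen_lt_gen hmono (by omega) (by omega) (by omega)
    have h := (boundS'_le_NS (a := a) hp (mem_Icc.2 ⟨by omega, hi.2⟩ : i.1 + 1 ∈ _)).trans hn
    have e : boundS' a (i + 1) = gen a (p - 1) * (
        ((p : ℚ) - 2) * (exchangeMult a i * (gen a p - gen a (i + 1))) + dGcd a * gen a p)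
        / (gen a p - gen a (p - 1)) := by
      rw [boundS', div_eq_div_iff (mul_neg_of_neg_of_pos (sub_neg.2 h12) (hg i)).ne
        (sub_pos.2 h12).ne']
      linear_combination ((gen a (p - 1) : ℚ) * (p - 2) * (gen a p - gen a (i + 1)) *
        (gen a p - gen a (p - 1))) * hmul i
    rw [e, div_le_iff₀ (sub_pos.2 h12)] at h
    simp only [e0, e1, ei i, hcard]
    have h' : (gen a (p - 1) : ℤ) * (((p : ℤ) - 2) * (exchangeMult a i * (gen a p - gen a (i + 1)))
        + dGcd a * gen a p) ≤ gen a 1 * n * (gen a p - gen a (p - 1)) := by exact_mod_cast h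
    rw [sub_sub_cancel]
    -- The summand of S'_i containing d a_p is nonnegative and can be dropped.
    have : (0 : ℤ) ≤ gen a (p - 1) * (dGcd a * gen a p) := by positivity
    linarith

end Bound

end NumSemi

theorem mainTheorem1 (S : AddSubmonoid ℕ) (hS : IsNumericalSemigroup S)
    (p : ℕ) (a : Fin p → ℕ) (hpos : ∀ i, 0 < a i) (hmono : StrictMono a)
    (hgen : AddSubmonoid.closure (Set.range a) = S) :
    (∃ N : ℕ, NumSemi.PeriodicFrom (NumSemi.deltaNu S a)
        (Nat.lcm (NumSemi.gen a 1) (NumSemi.gen a p)) N) ∧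
      ∀ hp : 3 ≤ p, NumSemi.PeriodicFrom (NumSemi.deltaNu S a)
        (Nat.lcm (NumSemi.gen a 1) (NumSemi.gen a p)) (NumSemi.N0 a hp) := by
  have hp0 : 1 ≤ p := by
    by_contra! h
    obtain rfl : p = 0 := by omega
    -- Without generators even g = 0 divides all of them, which would give 0 = 1.
    exact absurd (NumSemi.eq_one_of_forall_dvd (g := 0) hS hgen fun i => i.elim0) (by norm_num)
  have h1 : 0 < NumSemi.gen a 1 := by
    rw [NumSemi.gen_eq ⟨0, by omega⟩ rfl]
    exact hpos _
  have hlcm : 0 < Nat.lcm (NumSemi.gen a 1) (NumSemi.gen a p) := by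
    refine Nat.lcm_pos h1 ?_
    rw [NumSemi.gen_eq ⟨p - 1, by omega⟩ (by simp; omega)]
    exact hpos _
  refine ⟨?_, fun hp => ⟨hlcm, fun n hn => ?_⟩⟩
  · rcases hp0.eq_or_lt with rfl | hp
    · refine ⟨0, hlcm, fun n _ => ?_⟩
      rw [NumSemi.deltaNu_eq_empty_of_subsingleton hpos hgen,
        NumSemi.deltaNu_eq_empty_of_subsingleton hpos hgen]
    · obtain ⟨N, hN⟩ := (NumSemi.gapData hp hpos hmono hS hgen).exists_largeLength
      exact ⟨N, hlcm, fun n hn =>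
        NumSemi.deltaNu_add_lcm hp hpos hmono hS hgen (hN n (by exact_mod_cast hn))⟩
  · refine NumSemi.deltaNu_add_lcm (by omega) hpos hmono hS hgen
      (NumSemi.largeLength_of_NS_le hp hpos hmono hS hgen ?_)
    -- Only the term N_S / a_1 of the maximum N_0 is needed.
    have := (le_max_left _ _).trans hn
    rwa [div_le_iff₀' (by exact_mod_cast h1)] at this
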